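/- Robots are points of the Euclidean plane. A configuration $C$ is the finite multiset of the positions of all robots, and $|C|$ is the number of robots. An algorithm assigns to every configuration $C$ and every position $P\in C$ a probability distribution with finite support on the plane; the support $\mathrm{Pos}_{\mathcal A}(C,P)$ is the set of possible destinations of a robot at $P$, and $k_{\mathcal A}(C,P)=|\mathrm{Pos}_{\mathcal A}(C,P)|$ is the destination function. In each fully synchronous round all robots observe the current configuration $C$ and then, independently, each robot at a position $P$ moves to a destination drawn from the distribution assigned to $(C,P)$. A configuration is scattered if no two robots share a position. $\mathcal A$ is a scattering algorithm if from every initial configuration a scattered configuration is reached almost surely after finitely many rounds; it is canonical if each of its distributions is uniform on $\mathrm{Pos}_{\mathcal A}(C,P)$ and $\mathrm{Pos}_{\mathcal A}(C,P)\cap \mathrm{Pos}_{\mathcal A}(C,Q)=\emptyset$ for distinct positions $P,Q\in C$. A choice among $k$ destinations uses $\log_2 k$ random bits, and bits used by a robot that is alone at its position are not counted. Let $W_{\mathcal A}(n)\in[0,\infty]$ be the supremum, over all initial configurations of $n$ robots, of the expected total number of random bits used before the robots are scattered. Theorem. Let $\mathcal A$ be a canonical scattering algorithm whose destination function is polynomially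 bounded in the number of robots: there are $K,n_0\in\mathbb N$ and $c\in\mathbb R$ with $k_{\mathcal A}(C,P)\le c\,|C|^K$ for all configurations $C$ with $|C|\ge n_0$ and all $P\in C$. Then the expected number of random bits that $\mathcal A$ uses to scatter $n$ robots is $O(n\log n)$: there is a constant $c'$ with $W_{\mathcal A}(n)\le c'\,n\log_2 n$ for all $n\ge n_0$. Consequently $\mathcal A$ is random bit optimal: for every scattering algorithm $\mathcal B$, canonical or not, $W_{\mathcal A}(n)=O(W_{\mathcal B}(n))$ as $n\to\infty$. -/

import Mathlib

open MeasureTheory ProbabilityTheory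
open scoped ENNReal NNReal

noncomputable section

namespace Robots

/-- The Euclidean plane in which the robots move. -/
abbrev Plane : Type := EuclideanSpace ℝ (Fin 2)

/-- An (oblivious) mobile robot algorithm. A robot that observes the configuration `C` (the multiset
of the positions of all robots) from the position `P` moves to a destination drawn from `dest C P`.
A single choice has only finitely many possible outcomes. -/
structure Algorithm where
  dest : Multiset Plane → Plane → PMF Plane
  finite_support : ∀ C P, (dest C P).support.Finite

/-- The positions of `n` (labelled) robots. -/
def Placement (n : ℕ) : Type := Fin n → Plane

/-- Placements carry the discrete σ-algebra: algorithms are arbitrary functions of the observation. -/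
instance (n : ℕ) : MeasurableSpace (Placement n) := ⊤

/-- The configuration (multiset of positions) of a placement. -/
def Placement.config {n : ℕ} (x : Placement n) : Multiset Plane :=
  Finset.univ.val.map (fun i : Fin n => x i)

/-- No two robots share a position. -/
def Placement.Scattered {n : ℕ} (x : Placement n) : Prop :=
  ∀ i j : Fin n, x i = x j → i = j

/-- Robot `i` is located at a point of multiplicity. -/
def Placement.AtMultiplicity {n : ℕ} (x : Placement n) (i : Fin n) : Prop :=
  ∃ j : Fin n, j ≠ i ∧ x j = x i

namespace Algorithm

variable (A : Algorithm)

/-- The set of possible destinations of a robot that observes `C` from `P`. -/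
def pos (C : Multiset Plane) (P : Plane) : Finset Plane := (A.finite_support C P).toFinset

/-- The destination function: the number of possible destinations. -/
def numDest (C : Multiset Plane) (P : Plane) : ℕ := (A.pos C P).card

/-- The algorithm is canonical: every robot chooses uniformly among its possible destinations, and
the possible destinations of robots at different positions are different. -/
structure IsCanonical : Prop where
  uniform : ∀ C : Multiset Plane, ∀ P ∈ C, ∀ D ∈ A.pos C P,
    A.dest C P D = (A.numDest C P : ℝ≥0∞)⁻¹
  disjoint : ∀ C : Multiset Plane, ∀ P ∈ C, ∀ Q ∈ C, P ≠ Q → Disjoint (A.pos C P) (A.pos C Q)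

theorem hasSum_step {n : ℕ} (x : Placement n) :
    HasSum (fun y : Placement n => ∏ i : Fin n, A.dest x.config (x i) (y i)) 1 := by
  classical
  have h1 : ∀ i : Fin n, ∑ D ∈ A.pos x.config (x i), A.dest x.config (x i) D = 1 := by
    intro i
    rw [← (A.dest x.config (x i)).tsum_coe]
    refine (tsum_eq_sum fun D hD => ?_).symm
    simpa [pos, PMF.mem_support_iff] using hD
  have h2 : ∑ y ∈ Fintype.piFinset (fun i : Fin n => A.pos x.config (x i)),
      ∏ i : Fin n, A.dest x.config (x i) (y i) = 1 := by
    rw [← Finset.prod_univ_sum]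
    simp [h1]
  rw [← h2]
  change HasSum (fun y : Fin n → Plane => ∏ i : Fin n, A.dest x.config (x i) (y i)) _
  refine hasSum_sum_of_ne_finset_zero fun y hy => ?_
  rw [Fintype.mem_piFinset, not_forall] at hy
  obtain ⟨i, hi⟩ := hy
  refine Finset.prod_eq_zero (Finset.mem_univ i) ?_
  simpa [pos, PMF.mem_support_iff] using hi

/-- One fully synchronous round from the placement `x`: all robots observe the same configuration
and independently move to a random destination. -/
def step {n : ℕ} (x : Placement n) : PMF (Placement n) :=
  ⟨fun y => ∏ i : Fin n, A.dest x.config (x i) (y i), A.hasSum_step x⟩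

/-- The transition kernel of one round. -/
def stepKernel (n : ℕ) : Kernel (Placement n) (Placement n) where
  toFun x := (A.step x).toMeasure
  measurable' := measurable_from_top

instance (n : ℕ) : IsMarkovKernel (A.stepKernel n) :=
  ⟨fun x => PMF.toMeasure.isProbabilityMeasure (A.step x)⟩

/-- The law of the next placement given the history of the execution: it depends only on the
current placement. -/
def historyKernel (n t : ℕ) : Kernel (Π _ : Finset.Iic t, Placement n) (Placement n) :=
  (A.stepKernel n).comap (fun h => h ⟨t, Finset.mem_Iic.2 le_rfl⟩) (measurable_pi_apply _)

instance (n t : ℕ) : IsMarkovKernel (A.historyKernel n t) := by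
  unfold historyKernel; infer_instance

/-- The law of the (infinite) fully synchronous execution of `A` with initial placement `x₀`. -/
def execution {n : ℕ} (x₀ : Placement n) : Measure (ℕ → Placement n) :=
  Kernel.trajMeasure (X := fun _ => Placement n) (Measure.dirac x₀) (A.historyKernel n)

/-- `A` is a scattering algorithm: from every initial placement of any number of robots, almost
surely no two robots share a position after finitely many rounds. -/
def IsScattering : Prop :=
  ∀ (n : ℕ) (x₀ : Placement n), ∀ᵐ ω ∂(A.execution x₀), ∃ t, (ω t).Scattered

open Classical in
/-- The number of random bits used in one round: a choice among `k` destinations takes `log₂ k`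
bits; robots that are alone at their position are not counted. -/
def roundBits {n : ℕ} (x : Placement n) : ℝ≥0∞ :=
  ∑ i : Fin n, if x.AtMultiplicity i then
    ENNReal.ofReal (Real.logb 2 (A.numDest x.config (x i))) else 0

open Classical in
/-- The number of random bits used in an execution before the robots are scattered. -/
def bitsToScatter {n : ℕ} (ω : ℕ → Placement n) : ℝ≥0∞ :=
  ∑' t : ℕ, if ∀ s ≤ t, ¬ (ω s).Scattered then A.roundBits (ω t) else 0

/-- The random bit complexity: the largest expected number of random bits that `A` uses to scatter
`n` robots, over all initial placements. -/
def bitComplexity (n : ℕ) : ℝ≥0∞ :=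
  ⨆ x₀ : Placement n, ∫⁻ ω, A.bitsToScatter ω ∂(A.execution x₀)

/-- `A` is random bit optimal: up to a constant factor, no scattering algorithm (canonical or not)
has a smaller random bit complexity. -/
def RandomBitOptimal : Prop :=
  ∀ B : Algorithm, B.IsScattering → ∃ (c : ℝ≥0) (n₀ : ℕ), ∀ n : ℕ, n₀ ≤ n →
    A.bitComplexity n ≤ c * B.bitComplexity n

end Algorithm

end Robots

end

/-!
Upper bound: let `L` bound the bits of a single choice, and give every robot at a position of
multiplicity `m` the potential `3 log₂ m + 4 L (1 - 1 / m)`. A canonical algorithm never lets robots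
meet again once they are separated, and robots that share a position with `k` destinations choose
alike with probability `1 / k`, so after one round the expected multiplicity is at most
`1 + (m - 1) / k`. The potential is concave and increasing, hence by Jensen its expectation drops by
at least the `log₂ k` bits spent, and its initial value bounds the expected total number of bits.

Lower bound: let `G` be the group of permutations of the robots that preserve the placement. In one
round the order of `G` shrinks by at most a factor equal to the product of the numbers of
destinations of the robots at points of multiplicity, so `log₂ |G|` drops by at most the bits spent.
It falls from `log₂ n!` for gathered robots to `0` for scattered ones, and `n log₂ n ≤ 2 log₂ n!`.
-/

namespace Robots

section MarkovChain

variable {X : Type*}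

/-- The trajectories that do not visit `S` at any of the times `0, …, t`. -/
def avoidingUpTo (S : Set X) (t : ℕ) : Set (ℕ → X) := {ω | ∀ s ≤ t, ω s ∉ S}

/-- The total running cost of a trajectory strictly before its first visit to `S`, where a visit to
the state `x` costs `r x`. -/
noncomputable def costBefore (S : Set X) (r : X → ℝ≥0∞) (ω : ℕ → X) : ℝ≥0∞ :=
  ∑' t, (avoidingUpTo S t).indicator (fun ω => r (ω t)) ω

theorem avoidingUpTo_succ (S : Set X) (t : ℕ) :
    avoidingUpTo S (t + 1) = avoidingUpTo S t ∩ {ω | ω (t + 1) ∉ S} := by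
  ext ω
  simp only [avoidingUpTo, Nat.le_add_one_iff, or_imp, forall_and, forall_eq, Set.mem_ofPred_eq,
    Set.mem_inter_iff]

theorem antitone_avoidingUpTo (S : Set X) : Antitone (avoidingUpTo S) :=
  fun _ _ hst _ hω r hr => hω r (hr.trans hst)

variable [MeasurableSpace X]

theorem measurableSet_piLE_avoidingUpTo {S : Set X} (hS : MeasurableSet S) (t : ℕ) :
    MeasurableSet[Filtration.piLE (X := fun _ : ℕ => X) t] (avoidingUpTo S t) := by
  have preimage_eq : avoidingUpTo S t =
      Preorder.frestrictLe t ⁻¹' ⋂ s : Finset.Iic t, (fun h => h s) ⁻¹' Sᶜ := by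
    ext ω
    simp [avoidingUpTo]
  rw [Filtration.piLE_eq_comap_frestrictLe, preimage_eq]
  exact ⟨_, .iInter fun s => measurable_pi_apply s hS.compl, rfl⟩

theorem measurableSet_avoidingUpTo {S : Set X} (hS : MeasurableSet S) (t : ℕ) :
    MeasurableSet (avoidingUpTo S t) :=
  Filtration.piLE.le t _ (measurableSet_piLE_avoidingUpTo hS t)

theorem lintegral_costBefore (P : Measure (ℕ → X)) {S : Set X} (hS : MeasurableSet S)
    {r : X → ℝ≥0∞} (hr : Measurable r) :
    ∫⁻ ω, costBefore S r ω ∂P = ∑' t, ∫⁻ ω in avoidingUpTo S t, r (ω t) ∂P := by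
  unfold costBefore
  simp_rw [← lintegral_indicator (measurableSet_avoidingUpTo hS _)]
  exact lintegral_tsum fun t => ((hr.comp (measurable_pi_apply t)).indicator
    (measurableSet_avoidingUpTo hS t)).aemeasurable

/-- Entering `S` at time `t + 1` contributes nothing, so the stopping condition can be advanced by
one step. -/
theorem setLIntegral_avoidingUpTo_succ (P : Measure (ℕ → X)) {S : Set X} (hS : MeasurableSet S)
    {Φ : X → ℝ≥0∞} (hΦS : ∀ x ∈ S, Φ x = 0) (t : ℕ) :
    ∫⁻ ω in avoidingUpTo S (t + 1), Φ (ω (t + 1)) ∂P =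
      ∫⁻ ω in avoidingUpTo S t, Φ (ω (t + 1)) ∂P := by
  rw [← lintegral_indicator (measurableSet_avoidingUpTo hS _),
    ← lintegral_indicator (measurableSet_avoidingUpTo hS _), avoidingUpTo_succ]
  refine lintegral_congr fun ω => ?_
  rw [Set.inter_comm, ← Set.indicator_indicator]
  by_cases hω : ω (t + 1) ∈ S
  · rw [Set.indicator_of_notMem (not_not.2 hω)]
    exact ((avoidingUpTo S t).indicator_apply_eq_zero (f := fun ω => Φ (ω (t + 1))) |>.2
      fun _ => hΦS _ hω).symm
  · exact Set.indicator_of_mem hω _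

/-- The law of the trajectory of the time-homogeneous Markov chain with transition kernel `κ` and
initial distribution `μ`, as a measure on the space of infinite sequences of states. -/
noncomputable def markovChain (κ : Kernel X X) [IsMarkovKernel κ] (μ : Measure X) :
    Measure (ℕ → X) :=
  Kernel.trajMeasure (X := fun _ => X) μ fun t =>
    κ.comap (fun h : Π _ : Finset.Iic t, X => h ⟨t, Finset.mem_Iic.2 le_rfl⟩)
      (measurable_pi_apply _)

variable (κ : Kernel X X) [IsMarkovKernel κ] (μ : Measure X)

instance [IsProbabilityMeasure μ] : IsProbabilityMeasure (markovChain κ μ) := by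
  unfold markovChain
  infer_instance

theorem map_eval_zero_markovChain : (markovChain κ μ).map (fun ω => ω 0) = μ := by
  have map_frestrictLe : (markovChain κ μ).map (Preorder.frestrictLe 0) =
      μ.map (MeasurableEquiv.piUnique fun _ : Finset.Iic 0 => X).symm := by
    unfold markovChain Kernel.trajMeasure
    rw [Measure.map_comp _ _ (by fun_prop), Kernel.traj_map_frestrictLe, Kernel.partialTraj_self]
    exact Measure.id_comp
  have eval_zero_eq : (fun ω : ℕ → X => ω 0) =
      (fun h : Π _ : Finset.Iic 0, X => h ⟨0, Finset.mem_Iic.2 le_rfl⟩) ∘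
        Preorder.frestrictLe 0 := rfl
  rw [eval_zero_eq, ← Measure.map_map (by fun_prop) (by fun_prop), map_frestrictLe,
    Measure.map_map (by fun_prop) (by fun_prop)]
  exact Measure.map_id

theorem lintegral_markovChain_zero {f : X → ℝ≥0∞} (hf : Measurable f) :
    ∫⁻ ω, f (ω 0) ∂(markovChain κ μ) = ∫⁻ x, f x ∂μ := by
  rw [← lintegral_map (g := fun ω : ℕ → X => ω 0) hf (by fun_prop), map_eval_zero_markovChain]

variable [IsProbabilityMeasure μ]

theorem setLIntegral_markovChain_succ {t : ℕ} {E : Set (ℕ → X)}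
    (hE : MeasurableSet[Filtration.piLE (X := fun _ : ℕ => X) t] E) {f : X → ℝ≥0∞}
    (hf : Measurable f) :
    ∫⁻ ω in E, f (ω (t + 1)) ∂(markovChain κ μ) =
      ∫⁻ ω in E, ∫⁻ y, f y ∂(κ (ω t)) ∂(markovChain κ μ) := by
  rw [Filtration.piLE_eq_comap_frestrictLe] at hE
  obtain ⟨H, hH, rfl⟩ := hE
  set now : (Π _ : Finset.Iic t, X) → X := fun h => h ⟨t, Finset.mem_Iic.2 le_rfl⟩
  have hnow : Measurable now := measurable_pi_apply _
  have hf_snd : Measurable fun p : (Π _ : Finset.Iic t, X) × X => f p.2 := hf.comp measurable_snd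
  have compProd_eq : (markovChain κ μ).map (Preorder.frestrictLe t) ⊗ₘ κ.comap now hnow =
      (markovChain κ μ).map fun ω => (Preorder.frestrictLe t ω, ω (t + 1)) :=
    Kernel.map_frestrictLe_trajMeasure_compProd_eq_map_trajMeasure (X := fun _ => X)
  calc ∫⁻ ω in Preorder.frestrictLe t ⁻¹' H, f (ω (t + 1)) ∂(markovChain κ μ)
      = ∫⁻ p in H ×ˢ Set.univ, f p.2
          ∂((markovChain κ μ).map fun ω => (Preorder.frestrictLe t ω, ω (t + 1))) := by
        rw [setLIntegral_map (hH.prod .univ) hf_snd (by fun_prop),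
          Set.mk_preimage_prod, Set.preimage_univ, Set.inter_univ]
    _ = ∫⁻ h in H, ∫⁻ y, f y ∂(κ (now h))
          ∂((markovChain κ μ).map (Preorder.frestrictLe t)) := by
        rw [← compProd_eq, Measure.setLIntegral_compProd hf_snd hH .univ]
        simp only [Measure.restrict_univ, Kernel.comap_apply]
    _ = ∫⁻ ω in Preorder.frestrictLe t ⁻¹' H, ∫⁻ y, f y ∂(κ (ω t)) ∂(markovChain κ μ) :=
        setLIntegral_map hH (hf.lintegral_kernel.comp hnow) (by fun_prop)

variable {κ} {S : Set X} {r Φ : X → ℝ≥0∞}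

/-- Telescoping the drift inequality over the rounds before `S` is reached. -/
theorem lintegral_costBefore_le (hS : MeasurableSet S) (hr : Measurable r) (hΦ : Measurable Φ)
    (drift : ∀ x ∉ S, ∫⁻ y, Φ y ∂(κ x) + r x ≤ Φ x) :
    ∫⁻ ω, costBefore S r ω ∂(markovChain κ μ) ≤ ∫⁻ x, Φ x ∂μ := by
  have hr_eval (t : ℕ) : Measurable fun ω : ℕ → X => r (ω t) := hr.comp (measurable_pi_apply t)
  have one_step (t : ℕ) :
      ∫⁻ ω in avoidingUpTo S t, r (ω t) ∂(markovChain κ μ) +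
          ∫⁻ ω in avoidingUpTo S (t + 1), Φ (ω (t + 1)) ∂(markovChain κ μ) ≤
        ∫⁻ ω in avoidingUpTo S t, Φ (ω t) ∂(markovChain κ μ) := by
    calc _ ≤ ∫⁻ ω in avoidingUpTo S t, r (ω t) ∂(markovChain κ μ) +
          ∫⁻ ω in avoidingUpTo S t, Φ (ω (t + 1)) ∂(markovChain κ μ) := by
          gcongr
          exact antitone_avoidingUpTo S t.le_succ
      _ = ∫⁻ ω in avoidingUpTo S t, (∫⁻ y, Φ y ∂(κ (ω t)) + r (ω t)) ∂(markovChain κ μ) := by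
          rw [setLIntegral_markovChain_succ κ μ (measurableSet_piLE_avoidingUpTo hS t) hΦ,
            lintegral_add_right _ (hr_eval t), add_comm]
      _ ≤ _ := setLIntegral_mono' (measurableSet_avoidingUpTo hS t)
          fun ω hω => drift _ (hω t le_rfl)
  have telescoped (N : ℕ) :
      ∑ t ∈ Finset.range N, ∫⁻ ω in avoidingUpTo S t, r (ω t) ∂(markovChain κ μ) +
        ∫⁻ ω in avoidingUpTo S N, Φ (ω N) ∂(markovChain κ μ) ≤ ∫⁻ x, Φ x ∂μ := by
    induction N with
    | zero =>
      rw [Finset.sum_range_zero, zero_add, ← lintegral_markovChain_zero κ μ hΦ]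
      exact setLIntegral_le_lintegral _ _
    | succ N ih =>
      rw [Finset.sum_range_succ, add_assoc]
      exact (add_le_add_right (one_step N) _).trans ih
  rw [lintegral_costBefore _ hS hr, ENNReal.tsum_eq_iSup_nat]
  exact iSup_le fun N => le_self_add.trans (telescoped N)

theorem lintegral_le_sum_add_setLIntegral (hS : MeasurableSet S) (hr : Measurable r)
    (hΦ : Measurable Φ) (hΦS : ∀ x ∈ S, Φ x = 0)
    (drift : ∀ x ∉ S, Φ x ≤ ∫⁻ y, Φ y ∂(κ x) + r x) (N : ℕ) :
    ∫⁻ x, Φ x ∂μ ≤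
      ∑ t ∈ Finset.range N, ∫⁻ ω in avoidingUpTo S t, r (ω t) ∂(markovChain κ μ) +
        ∫⁻ ω in avoidingUpTo S N, Φ (ω N) ∂(markovChain κ μ) := by
  have hr_eval (t : ℕ) : Measurable fun ω : ℕ → X => r (ω t) := hr.comp (measurable_pi_apply t)
  have one_step (t : ℕ) :
      ∫⁻ ω in avoidingUpTo S t, Φ (ω t) ∂(markovChain κ μ) ≤
        ∫⁻ ω in avoidingUpTo S t, r (ω t) ∂(markovChain κ μ) +
          ∫⁻ ω in avoidingUpTo S (t + 1), Φ (ω (t + 1)) ∂(markovChain κ μ) := by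
    calc _ ≤ ∫⁻ ω in avoidingUpTo S t, (∫⁻ y, Φ y ∂(κ (ω t)) + r (ω t)) ∂(markovChain κ μ) :=
          setLIntegral_mono' (measurableSet_avoidingUpTo hS t) fun ω hω => drift _ (hω t le_rfl)
      _ = _ := by
          rw [setLIntegral_avoidingUpTo_succ _ hS hΦS,
            setLIntegral_markovChain_succ κ μ (measurableSet_piLE_avoidingUpTo hS t) hΦ,
            lintegral_add_right _ (hr_eval t), add_comm]
  induction N with
  | zero =>
    rw [Finset.sum_range_zero, zero_add, ← lintegral_markovChain_zero κ μ hΦ,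
      ← lintegral_indicator (measurableSet_avoidingUpTo hS 0)]
    refine lintegral_mono fun ω => ?_
    by_cases hω : ω 0 ∈ S <;> simp [avoidingUpTo, hω, hΦS]
  | succ N ih =>
    rw [Finset.sum_range_succ, add_assoc]
    exact ih.trans (add_le_add_right (one_step N) _)

theorem tendsto_measure_avoidingUpTo (P : Measure (ℕ → X)) [IsFiniteMeasure P]
    (hS : MeasurableSet S) (hit : ∀ᵐ ω ∂P, ∃ t, ω t ∈ S) :
    Filter.Tendsto (fun t => P (avoidingUpTo S t)) Filter.atTop (nhds 0) := by
  have never_null : P (⋂ t, avoidingUpTo S t) = 0 := by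
    refine measure_mono_null (fun ω hω => ?_) (ae_iff.1 hit)
    rintro ⟨t, ht⟩
    exact Set.mem_iInter.1 hω t t le_rfl ht
  rw [← never_null]
  exact tendsto_measure_iInter_atTop
    (fun t => (measurableSet_avoidingUpTo hS t).nullMeasurableSet) (antitone_avoidingUpTo S)
    ⟨0, measure_ne_top _ _⟩

/-- Boundedness of `Φ` makes the part of `Φ` that has not been paid for by time `N` vanish as
`N → ∞`. -/
theorem lintegral_le_lintegral_costBefore (hS : MeasurableSet S) (hr : Measurable r)
    (hΦ : Measurable Φ) (hΦS : ∀ x ∈ S, Φ x = 0)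
    (drift : ∀ x ∉ S, Φ x ≤ ∫⁻ y, Φ y ∂(κ x) + r x)
    {M : ℝ≥0∞} (hM : M ≠ ∞) (hΦM : ∀ x, Φ x ≤ M)
    (hit : ∀ᵐ ω ∂(markovChain κ μ), ∃ t, ω t ∈ S) :
    ∫⁻ x, Φ x ∂μ ≤ ∫⁻ ω, costBefore S r ω ∂(markovChain κ μ) := by
  have remainder_tendsto : Filter.Tendsto
      (fun N => ∫⁻ ω, costBefore S r ω ∂(markovChain κ μ) +
        M * markovChain κ μ (avoidingUpTo S N)) Filter.atTop
      (nhds (∫⁻ ω, costBefore S r ω ∂(markovChain κ μ))) := by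
    simpa using (ENNReal.Tendsto.const_mul (tendsto_measure_avoidingUpTo _ hS hit)
      (Or.inr hM)).const_add (∫⁻ ω, costBefore S r ω ∂(markovChain κ μ))
  refine ge_of_tendsto' remainder_tendsto fun N =>
    (lintegral_le_sum_add_setLIntegral μ hS hr hΦ hΦS drift N).trans (add_le_add ?_ ?_)
  · rw [lintegral_costBefore _ hS hr]
    exact ENNReal.sum_le_tsum _
  · rw [← setLIntegral_const]
    exact lintegral_mono fun ω => hΦM _

end MarkovChain

section Averages

open Finset
open scoped BigOperators

variable {ι : Type*}

theorem card_filter_piFinset_apply_eq_mul_card_le [Fintype ι] [DecidableEq ι] {α : Type*}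
    [DecidableEq α] (s : ι → Finset α) {i j : ι} (hij : i ≠ j) :
    #{f ∈ Fintype.piFinset s | f i = f j} * #(s i) ≤ #(Fintype.piFinset s) := by
  rw [← card_product]
  refine card_le_card_of_injOn (fun p => Function.update p.1 i p.2) ?_ ?_
  · rintro ⟨f, a⟩ hp
    simp only [coe_product, Set.mem_prod, mem_coe, mem_filter, Fintype.mem_piFinset] at hp ⊢
    intro l
    rcases eq_or_ne l i with rfl | hl
    · simpa using hp.2
    · simpa [hl] using hp.1.1 l
  · rintro ⟨f, a⟩ hp ⟨g, b⟩ hq heq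
    simp only [coe_product, Set.mem_prod, mem_coe, mem_filter] at hp hq
    have eq_off : ∀ l, l ≠ i → f l = g l := fun l hl => by simpa [hl] using congrFun heq l
    refine Prod.ext (funext fun l => ?_) (by simpa using congrFun heq i)
    rcases eq_or_ne l i with rfl | hl
    · exact hp.1.2.trans ((eq_off j hij.symm).trans hq.1.2.symm)
    · exact eq_off l hl

theorem expect_piFinset_ite_apply_eq_le [Fintype ι] [DecidableEq ι] {α : Type*}
    [DecidableEq α] (s : ι → Finset α) {i j : ι} (hij : i ≠ j) :
    𝔼 f ∈ Fintype.piFinset s, (if f i = f j then (1 : ℝ) else 0) ≤ (#(s i) : ℝ)⁻¹ := by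
  rcases (s i).eq_empty_or_nonempty with hs | hs
  · have : Fintype.piFinset s = ∅ :=
      eq_empty_of_forall_notMem fun f hf => by simpa [hs] using Fintype.mem_piFinset.1 hf i
    simp [this]
  rw [expect_eq_sum_div_card, sum_boole]
  refine div_le_of_le_mul₀ (by positivity) (by positivity) ?_
  rw [← div_eq_inv_mul, le_div_iff₀ (by exact_mod_cast hs.card_pos)]
  exact_mod_cast card_filter_piFinset_apply_eq_mul_card_le s hij

theorem expect_comp_le_of_concaveOn {s : Finset ι} (hs : s.Nonempty) {D : Set ℝ}
    {f : ℝ → ℝ} (hf : ConcaveOn ℝ D f) {p : ι → ℝ} (hp : ∀ i ∈ s, p i ∈ D) :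
    𝔼 i ∈ s, f (p i) ≤ f (𝔼 i ∈ s, p i) := by
  have hcard : (s.card : ℝ) ≠ 0 := by exact_mod_cast hs.card_ne_zero
  have := hf.le_map_sum (t := s) (w := fun _ => (s.card : ℝ)⁻¹) (p := p)
    (fun _ _ => by positivity) (by simp [hcard]) hp
  simpa only [expect_eq_sum_div_card, div_eq_inv_mul, mul_sum, smul_eq_mul] using this

theorem sum_ite_eq_ite_apply_eq [Fintype ι] [DecidableEq ι] {α 𝕜 : Type*} [DecidableEq α] [Field 𝕜]
    (f : ι → α) (i : ι) (k : 𝕜) :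
    ∑ j, (if j = i then 1 else if f j = f i then k⁻¹ else 0) =
      1 + (∑ j, (if f j = f i then 1 else 0) - 1) / k := by
  have split_term (j : ι) : (if j = i then 1 else if f j = f i then k⁻¹ else 0) =
      (if j = i then 1 - k⁻¹ else 0) + (if f j = f i then 1 else 0) * k⁻¹ := by
    split_ifs <;> simp_all
  simp_rw [split_term, sum_add_distrib, sum_ite_eq', mem_univ, if_true, ← sum_mul]
  ring

end Averages

theorem pow_self_le_factorial_sq (n : ℕ) : n ^ n ≤ n.factorial ^ 2 := by
  calc n ^ n = ∏ _i ∈ Finset.range n, n := by simp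
    _ ≤ ∏ i ∈ Finset.range n, (i + 1) * (n - 1 - i + 1) := by
        refine Finset.prod_le_prod' fun i hi => ?_
        obtain ⟨d, rfl⟩ := Nat.exists_eq_add_of_lt (Finset.mem_range.1 hi)
        rw [show i + d + 1 - 1 - i = d by omega]
        nlinarith [Nat.zero_le (i * d)]
    _ = n.factorial ^ 2 := by
        rw [Finset.prod_mul_distrib, Finset.prod_range_reflect (fun i => i + 1),
          Finset.prod_range_add_one_eq_factorial, sq]

theorem mul_logb_le_two_mul_logb_factorial {b : ℝ} (hb : 1 < b) (n : ℕ) :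
    n * Real.logb b n ≤ 2 * Real.logb b n.factorial := by
  rcases n.eq_zero_or_pos with rfl | hn
  · simp
  have hle : (n : ℝ) ^ n ≤ (n.factorial : ℝ) ^ 2 := by exact_mod_cast pow_self_le_factorial_sq n
  simpa only [Real.logb_pow, Nat.cast_ofNat] using
    Real.logb_le_logb_of_le hb (by positivity) hle

section SymmetryGroup

open MulAction
open scoped DomMulAct

theorem card_le_card_stabilizer_mul_ncard {G α : Type*} [Group G] [Finite G] [MulAction G α]
    (H : Subgroup G) (a : α) {T : Set α} (hT : T.Finite) (hHT : ∀ g ∈ H, g • a ∈ T) :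
    Nat.card H ≤ Nat.card (stabilizer G a) * T.ncard := by
  have stabilizer_le : Nat.card (stabilizer H a) ≤ Nat.card (stabilizer G a) :=
    Nat.card_le_card_of_injective (fun h => (⟨h.1, h.2⟩ : stabilizer G a))
      fun _ _ h => Subtype.ext (Subtype.ext (Subtype.mk.inj h))
  have orbit_subset : orbit H a ⊆ T := by
    rintro _ ⟨h, rfl⟩
    exact hHT _ h.2
  calc Nat.card H = Nat.card (stabilizer H a) * (orbit H a).ncard := by
        rw [← index_stabilizer, Subgroup.card_mul_index]
    _ ≤ Nat.card (stabilizer G a) * T.ncard :=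
        Nat.mul_le_mul stabilizer_le (Set.ncard_le_ncard orbit_subset hT)

/-- The symmetry group of a labelling `f`: the permutations `σ` of the labelled points such that
`f ∘ σ = f`. -/
abbrev symmetryGroup {ι α : Type*} (f : ι → α) : Subgroup (Equiv.Perm ι)ᵈᵐᵃ :=
  stabilizer (Equiv.Perm ι)ᵈᵐᵃ f

variable {ι α : Type*}

theorem mem_symmetryGroup {f : ι → α} {σ : (Equiv.Perm ι)ᵈᵐᵃ} :
    σ ∈ symmetryGroup f ↔ ∀ i, f (DomMulAct.mk.symm σ i) = f i :=
  DomMulAct.mem_stabilizer_iff.trans funext_iff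

theorem card_symmetryGroup_of_injective {f : ι → α} (hf : Function.Injective f) :
    Nat.card (symmetryGroup f) = 1 := by
  rw [Subgroup.card_eq_one, Subgroup.eq_bot_iff_forall]
  exact fun σ hσ => DomMulAct.mk.symm.injective (Equiv.ext fun i => hf (mem_symmetryGroup.1 hσ i))

variable [Finite ι]

instance : Finite (Equiv.Perm ι)ᵈᵐᵃ :=
  Finite.of_equiv _ DomMulAct.mk

theorem card_permDomMulAct : Nat.card (Equiv.Perm ι)ᵈᵐᵃ = (Nat.card ι).factorial :=
  (Nat.card_congr DomMulAct.mk).symm.trans Nat.card_perm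

theorem card_symmetryGroup_const (a : α) :
    Nat.card (symmetryGroup fun _ : ι => a) = (Nat.card ι).factorial := by
  have : symmetryGroup (fun _ : ι => a) = ⊤ :=
    eq_top_iff.2 fun σ _ => mem_symmetryGroup.2 fun _ => rfl
  rw [this, Subgroup.card_top, card_permDomMulAct]

theorem card_symmetryGroup_le (f : ι → α) :
    Nat.card (symmetryGroup f) ≤ (Nat.card ι).factorial :=
  (Subgroup.card_le_card_group _).trans_eq card_permDomMulAct

/-- The symmetries of `f` move `g` around inside a product of the sets `s (f i)`, in which the
points with a label of their own stay fixed. -/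
theorem card_symmetryGroup_le_mul_prod {β : Type*} (f : ι → α) (g : ι → β)
    (s : α → Finset β) (hg : ∀ i, g i ∈ s (f i)) {I : Finset ι}
    (hI : ∀ i ∉ I, ∀ j, f j = f i → j = i) :
    Nat.card (symmetryGroup f) ≤ Nat.card (symmetryGroup g) * ∏ i ∈ I, (s (f i)).card := by
  classical
  cases nonempty_fintype ι
  let T : Finset (ι → β) := Fintype.piFinset fun i => if i ∈ I then s (f i) else {g i}
  have card_T : T.card = ∏ i ∈ I, (s (f i)).card := by
    simp [T, Fintype.card_piFinset, apply_ite]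
  rw [← card_T, ← Set.ncard_coe_finset]
  refine card_le_card_stabilizer_mul_ncard _ g T.finite_toSet fun σ hσ => ?_
  have hfσ := mem_symmetryGroup.1 hσ
  refine Finset.mem_coe.2 (Fintype.mem_piFinset.2 fun i => ?_)
  rw [DomMulAct.smul_apply, Equiv.Perm.smul_def]
  split_ifs with hi
  · exact hfσ i ▸ hg _
  · rw [hI i hi _ (hfσ i), Finset.mem_singleton]

end SymmetryGroup

section Potential

/-- The contribution to the potential function of a robot at a position of multiplicity `m`, where
`L` bounds the number of random bits of a single choice. Choices among at most `m` destinations are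
paid for by the logarithm, choices among more than `m` destinations by the other summand. -/
noncomputable def potential (L m : ℝ) : ℝ := 3 * Real.logb 2 m + 4 * L * (1 - m⁻¹)

@[simp]
theorem potential_one (L : ℝ) : potential L 1 = 0 := by
  simp [potential]

variable {L : ℝ}

theorem concaveOn_potential (hL : 0 ≤ L) : ConcaveOn ℝ (Set.Ioi 0) (potential L) := by
  have hlogb : ConcaveOn ℝ (Set.Ioi 0) fun m => Real.logb 2 m := by
    simpa [Real.logb, div_eq_inv_mul] using
      strictConcaveOn_log_Ioi.concaveOn.smul (inv_nonneg.2 (Real.log_nonneg one_le_two))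
  have hinv : ConvexOn ℝ (Set.Ioi 0) fun m : ℝ => m⁻¹ := by
    simpa using convexOn_zpow (𝕜 := ℝ) (-1)
  exact (hlogb.smul zero_le_three).add
    (((concaveOn_const 1 (convex_Ioi 0)).sub hinv).smul (c := 4 * L) (by positivity))

theorem monotoneOn_potential (hL : 0 ≤ L) : MonotoneOn (potential L) (Set.Ioi 0) := by
  intro m hm m' _ hmm'
  rw [Set.mem_Ioi] at hm
  unfold potential
  gcongr
  norm_num

theorem potential_nonneg (hL : 0 ≤ L) {m : ℝ} (hm : 1 ≤ m) : 0 ≤ potential L m :=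
  potential_one L ▸ monotoneOn_potential hL (Set.mem_Ioi.2 one_pos) (one_pos.trans_le hm) hm

theorem two_mul_sub_one_pow_three_le_pow_five (k : ℕ) : (2 * (k : ℝ) - 1) ^ 3 ≤ (k : ℝ) ^ 5 := by
  rcases Nat.lt_or_ge k 3 with hk | hk
  · interval_cases k <;> norm_num
  · have hk' : (3 : ℝ) ≤ k := by exact_mod_cast hk
    calc (2 * (k : ℝ) - 1) ^ 3 ≤ (2 * (k : ℝ)) ^ 3 :=
          pow_le_pow_left₀ (by linarith) (by linarith) 3
      _ = 8 * (k : ℝ) ^ 3 := by ring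
      _ ≤ (k : ℝ) ^ 2 * (k : ℝ) ^ 3 := by gcongr; nlinarith
      _ = (k : ℝ) ^ 5 := by ring

/-- The base `1 + (m - 1) / k` agrees with `m * (2 * k - 1) / k ^ 2` at `m = k` and grows more
slowly in `m`, which reduces the claim to `m = k`. -/
theorem one_add_sub_one_div_pow_three_mul_le {m : ℝ} {k : ℕ} (hk : 1 ≤ k) (hkm : (k : ℝ) ≤ m) :
    (1 + (m - 1) / k) ^ 3 * k ≤ m ^ 3 := by
  have hk1 : (1 : ℝ) ≤ k := by exact_mod_cast hk
  have base_le : 1 + (m - 1) / k ≤ m * ((2 * k - 1) / k ^ 2) := by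
    have : m * ((2 * k - 1) / k ^ 2) - (1 + (m - 1) / k) = (m - k) * (k - 1) / k ^ 2 := by
      field_simp
      ring
    rw [← sub_nonneg, this]
    exact div_nonneg (mul_nonneg (by linarith) (by linarith)) (by positivity)
  have m_nonneg : 0 ≤ m := by linarith
  have base_nonneg : 0 ≤ (m - 1) / k := div_nonneg (by linarith) (by linarith)
  calc (1 + (m - 1) / k) ^ 3 * k
      ≤ (m * ((2 * k - 1) / k ^ 2)) ^ 3 * k := by gcongr
    _ = m ^ 3 * ((2 * k - 1) ^ 3 / k ^ 5) := by field_simp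
    _ ≤ m ^ 3 * 1 := by
        gcongr
        exact div_le_one_of_le₀ (two_mul_sub_one_pow_three_le_pow_five k) (by positivity)
    _ = m ^ 3 := mul_one _

theorem one_le_four_mul_inv_sub_inv {m k : ℝ} (hm : 2 ≤ m) (hmk : m + 1 ≤ k) :
    1 ≤ 4 * ((1 + (m - 1) / k)⁻¹ - m⁻¹) := by
  have hsum : 0 < k + m - 1 := by linarith
  have hk : k ≠ 0 := by linarith
  have mean_eq : 1 + (m - 1) / k = (k + m - 1) / k := by
    field_simp
    ring
  have diff_eq : 4 * ((1 + (m - 1) / k)⁻¹ - m⁻¹) =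
      2 * (m - 1) * (2 * (k - 1)) / (m * (k + m - 1)) := by
    rw [mean_eq]
    field_simp
    ring
  rw [diff_eq, one_le_div (by positivity)]
  exact mul_le_mul (by linarith) (by linarith) hsum.le (by linarith)

variable {m k : ℕ}

theorem potential_one_add_sub_one_div_add_logb_le (hm : 2 ≤ m) (hk : 1 ≤ k)
    (hkL : Real.logb 2 k ≤ L) :
    potential L (1 + (m - 1) / k) + Real.logb 2 k ≤ potential L m := by
  have hL : 0 ≤ L := (Real.logb_nonneg one_lt_two (by exact_mod_cast hk)).trans hkL
  have hm' : (2 : ℝ) ≤ m := by exact_mod_cast hm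
  have hk' : (1 : ℝ) ≤ k := by exact_mod_cast hk
  set μ : ℝ := 1 + (m - 1) / k with hμ
  have hμ_pos : 0 < μ := by
    have : 0 ≤ ((m : ℝ) - 1) / k := div_nonneg (by linarith) (by linarith)
    linarith
  have hμm : μ ≤ m := by
    have : ((m : ℝ) - 1) / k ≤ m - 1 := div_le_self (by linarith) hk'
    linarith
  unfold potential
  rcases le_or_gt k m with hkm | hmk
  · have log_drop : 3 * Real.logb 2 μ + Real.logb 2 k ≤ 3 * Real.logb 2 m := by
      have := Real.logb_le_logb_of_le one_lt_two (by positivity)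
        (one_add_sub_one_div_pow_three_mul_le hk (by exact_mod_cast hkm : (k : ℝ) ≤ m))
      rwa [← hμ, Real.logb_mul (by positivity) (by positivity), Real.logb_pow, Real.logb_pow,
        Nat.cast_ofNat] at this
    have inv_le : 4 * L * (1 - μ⁻¹) ≤ 4 * L * (1 - (m : ℝ)⁻¹) := by gcongr
    linarith
  · have log_le : Real.logb 2 μ ≤ Real.logb 2 m := Real.logb_le_logb_of_le one_lt_two hμ_pos hμm
    have inv_drop : L * 1 ≤ L * (4 * (μ⁻¹ - (m : ℝ)⁻¹)) :=
      mul_le_mul_of_nonneg_left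
        (one_le_four_mul_inv_sub_inv hm' (by exact_mod_cast hmk : (m : ℝ) + 1 ≤ k)) hL
    linarith

theorem potential_add_mul_logb_le {b a x : ℝ} (hb : 0 ≤ b) (ha : 0 ≤ a) (hx : 1 ≤ x) :
    potential (b + a * Real.logb 2 x) x ≤ (3 + 4 * (b + a)) * Real.logb 2 x := by
  have hlogb : 0 ≤ Real.logb 2 x := Real.logb_nonneg one_lt_two hx
  have log_le_logb : Real.log x ≤ Real.logb 2 x :=
    le_div_self (Real.log_nonneg hx) (Real.log_pos one_lt_two)
      (Real.log_two_lt_d9.le.trans (by norm_num))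
  have le_logb : 1 - x⁻¹ ≤ Real.logb 2 x :=
    (Real.one_sub_inv_le_log_of_pos (by linarith)).trans log_le_logb
  have le_one : 1 - x⁻¹ ≤ 1 := sub_le_self _ (by positivity)
  calc potential (b + a * Real.logb 2 x) x
      = 3 * Real.logb 2 x + 4 * (b * (1 - x⁻¹) + a * Real.logb 2 x * (1 - x⁻¹)) := by
        unfold potential
        ring
    _ ≤ 3 * Real.logb 2 x + 4 * (b * Real.logb 2 x + a * Real.logb 2 x * 1) := by gcongr
    _ = (3 + 4 * (b + a)) * Real.logb 2 x := by ring

end Potential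

namespace Placement

variable {n : ℕ}

instance : DiscreteMeasurableSpace (Placement n) := ⟨fun _ => trivial⟩

theorem mem_config (x : Placement n) (i : Fin n) : x i ∈ x.config :=
  Multiset.mem_map_of_mem _ (Finset.mem_univ_val i)

@[simp]
theorem card_config (x : Placement n) : x.config.card = n := by
  simp [config]

open Classical in
/-- The multiplicity of the position of robot `i`: the number of robots, including `i` itself, at
this position. -/
noncomputable def mult (x : Placement n) (i : Fin n) : ℕ := Finset.card {j | x j = x i}

theorem cast_mult (x : Placement n) (i : Fin n) :
    (x.mult i : ℝ) = ∑ j, if x j = x i then 1 else 0 := by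
  rw [mult, Finset.card_filter, Nat.cast_sum]
  push_cast
  congr!

theorem one_le_mult (x : Placement n) (i : Fin n) : 1 ≤ x.mult i :=
  Finset.card_pos.2 ⟨i, by simp⟩

theorem mult_le (x : Placement n) (i : Fin n) : x.mult i ≤ n :=
  (Finset.card_le_univ _).trans_eq (Fintype.card_fin n)

theorem atMultiplicity_iff_one_lt_mult (x : Placement n) (i : Fin n) :
    x.AtMultiplicity i ↔ 1 < x.mult i := by
  classical
  rw [mult, Finset.one_lt_card_iff_nontrivial]
  constructor
  · rintro ⟨j, hji, hj⟩
    exact ⟨j, by simpa using hj, i, by simp, hji⟩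
  · intro h
    obtain ⟨j, hj, hji⟩ := h.exists_ne i
    exact ⟨j, hji, by simpa using hj⟩

theorem mult_eq_one {x : Placement n} {i : Fin n} (hi : ¬ x.AtMultiplicity i) : x.mult i = 1 :=
  le_antisymm (not_lt.1 fun h => hi ((x.atMultiplicity_iff_one_lt_mult i).2 h)) (x.one_le_mult i)

/-- The number of random bits needed to break all symmetries between the robots. -/
noncomputable def symmetryBits (x : Placement n) : ℝ := Real.logb 2 (Nat.card (symmetryGroup x))

theorem symmetryBits_eq_zero {x : Placement n} (hx : x.Scattered) : x.symmetryBits = 0 := by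
  have card_eq : Nat.card (symmetryGroup x) = 1 :=
    card_symmetryGroup_of_injective fun i j hij => hx i j hij
  rw [symmetryBits, card_eq, Nat.cast_one, Real.logb_one]

theorem symmetryBits_le (x : Placement n) : x.symmetryBits ≤ Real.logb 2 n.factorial := by
  have card_le : Nat.card (symmetryGroup x) ≤ n.factorial := by
    simpa using card_symmetryGroup_le x
  exact Real.logb_le_logb_of_le one_lt_two (by exact_mod_cast Nat.card_pos)
    (by exact_mod_cast card_le)

theorem symmetryBits_eq_of_forall_eq {x : Placement n} {P : Plane} (hx : ∀ i, x i = P) :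
    x.symmetryBits = Real.logb 2 n.factorial := by
  have card_eq : Nat.card (symmetryGroup x) = n.factorial := by
    rw [show x = fun _ => P from funext hx]
    exact (card_symmetryGroup_const P).trans (by rw [Nat.card_fin])
  rw [symmetryBits, card_eq]

end Placement

namespace Algorithm

variable (A : Algorithm) {n : ℕ}

/-- The possible placements after one round from the placement `x`. -/
noncomputable def succs (x : Placement n) : Finset (Placement n) :=
  Fintype.piFinset fun i => A.pos x.config (x i)

variable {A} in
theorem mem_succs {x y : Placement n} : y ∈ A.succs x ↔ ∀ i, y i ∈ A.pos x.config (x i) :=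
  Fintype.mem_piFinset

theorem card_succs (x : Placement n) :
    (A.succs x).card = ∏ i, A.numDest x.config (x i) :=
  Fintype.card_piFinset _

theorem numDest_pos (C : Multiset Plane) (P : Plane) : 0 < A.numDest C P :=
  Finset.card_pos.2 ((Set.Finite.toFinset_nonempty _).2 (A.dest C P).support_nonempty)

theorem logb_numDest_nonneg (C : Multiset Plane) (P : Plane) :
    0 ≤ Real.logb 2 (A.numDest C P) :=
  Real.logb_nonneg one_lt_two (by exact_mod_cast A.numDest_pos C P)

theorem succs_nonempty (x : Placement n) : (A.succs x).Nonempty :=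
  Fintype.piFinset_nonempty.2 fun _ => Finset.card_pos.1 (A.numDest_pos _ _)

theorem step_apply (x y : Placement n) :
    A.step x y = ∏ i, A.dest x.config (x i) (y i) := rfl

theorem support_step (x : Placement n) : (A.step x).support = A.succs x := by
  ext y
  simp [PMF.mem_support_iff, step_apply, mem_succs, pos, Finset.prod_eq_zero_iff]

theorem ae_stepKernel_mem_succs (x : Placement n) : ∀ᵐ y ∂(A.stepKernel n x), y ∈ A.succs x := by
  rw [ae_iff]
  refine (PMF.toMeasure_apply_eq_zero_iff _ (.of_discrete)).2 ?_
  rw [support_step]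
  exact Set.disjoint_left.2 fun y hy h => h hy

theorem execution_eq_markovChain (x₀ : Placement n) :
    A.execution x₀ = markovChain (A.stepKernel n) (Measure.dirac x₀) := rfl

theorem bitsToScatter_eq_costBefore (ω : ℕ → Placement n) :
    A.bitsToScatter ω = costBefore {x | x.Scattered} A.roundBits ω := by
  classical
  refine tsum_congr fun t => ?_
  rw [Set.indicator_apply]
  exact if_congr Iff.rfl rfl rfl

open Classical in
theorem roundBits_eq_ofReal_sum (x : Placement n) :
    A.roundBits x =
      ENNReal.ofReal (∑ i with x.AtMultiplicity i, Real.logb 2 (A.numDest x.config (x i))) := by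
  refine Eq.trans ?_ (ENNReal.ofReal_sum_of_nonneg fun _ _ => A.logb_numDest_nonneg _ _).symm
  exact (Finset.sum_filter _ _).symm

theorem symmetryBits_le_symmetryBits_add_roundBits {x y : Placement n} (hy : y ∈ A.succs x) :
    ENNReal.ofReal x.symmetryBits ≤ ENNReal.ofReal y.symmetryBits + A.roundBits x := by
  classical
  have card_pos (z : Placement n) : (0 : ℝ) < Nat.card (symmetryGroup z) := by
    exact_mod_cast Nat.card_pos
  have numDest_ne_zero (i : Fin n) : (A.numDest x.config (x i) : ℝ) ≠ 0 := by
    exact_mod_cast (A.numDest_pos _ _).ne'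
  have card_le : (Nat.card (symmetryGroup x) : ℝ) ≤ Nat.card (symmetryGroup y) *
      ∏ i with x.AtMultiplicity i, (A.numDest x.config (x i) : ℝ) := by
    rw [← Nat.cast_prod, ← Nat.cast_mul, Nat.cast_le]
    refine card_symmetryGroup_le_mul_prod x y (A.pos x.config) (mem_succs.1 hy) fun i hi j hj => ?_
    by_contra hji
    exact hi (Finset.mem_filter.2 ⟨Finset.mem_univ i, j, hji, hj⟩)
  have bits_le := Real.logb_le_logb_of_le one_lt_two (card_pos x) card_le
  rw [Real.logb_mul (card_pos y).ne' (Finset.prod_ne_zero_iff.2 fun i _ => numDest_ne_zero i),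
    Real.logb_prod _ _ fun i _ => numDest_ne_zero i] at bits_le
  rw [roundBits_eq_ofReal_sum]
  exact (ENNReal.ofReal_le_ofReal bits_le).trans ENNReal.ofReal_add_le

theorem symmetryBits_le_lintegral_add_roundBits (x : Placement n) :
    ENNReal.ofReal x.symmetryBits ≤
      ∫⁻ y, ENNReal.ofReal y.symmetryBits ∂(A.stepKernel n x) + A.roundBits x := by
  calc ENNReal.ofReal x.symmetryBits = ∫⁻ _, ENNReal.ofReal x.symmetryBits ∂(A.stepKernel n x) := by
        simp
    _ ≤ ∫⁻ y, (ENNReal.ofReal y.symmetryBits + A.roundBits x) ∂(A.stepKernel n x) :=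
        lintegral_mono_ae ((A.ae_stepKernel_mem_succs x).mono fun y hy =>
          A.symmetryBits_le_symmetryBits_add_roundBits hy)
    _ = _ := by
        rw [lintegral_add_right _ measurable_const]
        simp

end Algorithm

namespace Algorithm.IsCanonical

open Finset
open scoped BigOperators

variable {A : Algorithm} (h : A.IsCanonical) {n : ℕ} (x : Placement n)
include h

theorem step_apply_of_mem {y : Placement n} (hy : y ∈ A.succs x) :
    A.step x y = (#(A.succs x) : ℝ≥0∞)⁻¹ := by
  have prod_inv : (∏ i, (A.numDest x.config (x i) : ℝ≥0∞))⁻¹ =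
      ∏ i, (A.numDest x.config (x i) : ℝ≥0∞)⁻¹ :=
    ENNReal.prod_inv_distrib fun i _ j _ _ => .inr (ENNReal.natCast_ne_top _)
  rw [step_apply, card_succs, Nat.cast_prod, prod_inv]
  exact prod_congr rfl fun i _ => h.uniform _ _ (x.mem_config i) _ (mem_succs.1 hy i)

theorem lintegral_stepKernel_ofReal {f : Placement n → ℝ} (hf : ∀ y, 0 ≤ f y) :
    ∫⁻ y, ENNReal.ofReal (f y) ∂(A.stepKernel n x) =
      ENNReal.ofReal (𝔼 y ∈ A.succs x, f y) := by
  have card_pos : (0 : ℝ) < #(A.succs x) := by exact_mod_cast (A.succs_nonempty x).card_pos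
  calc ∫⁻ y, ENNReal.ofReal (f y) ∂(A.stepKernel n x)
      = ∫⁻ y in (A.step x).support, ENNReal.ofReal (f y) ∂(A.step x).toMeasure := by
        rw [PMF.restrict_toMeasure_support]
        rfl
    _ = ∑ y ∈ A.succs x, ENNReal.ofReal (f y) * A.step x y := by
        rw [support_step, lintegral_finset]
        simp only [PMF.toMeasure_apply_singleton _ _ (measurableSet_singleton _)]
    _ = ∑ y ∈ A.succs x, ENNReal.ofReal (f y * (#(A.succs x) : ℝ)⁻¹) := by
        refine sum_congr rfl fun y hy => ?_
        rw [h.step_apply_of_mem x hy, ENNReal.ofReal_mul (hf y), ENNReal.ofReal_inv_of_pos card_pos,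
          ENNReal.ofReal_natCast]
    _ = ENNReal.ofReal (𝔼 y ∈ A.succs x, f y) := by
        rw [← ENNReal.ofReal_sum_of_nonneg fun y _ => mul_nonneg (hf y) (by positivity),
          ← sum_mul, ← div_eq_mul_inv, ← expect_eq_sum_div_card]

theorem eq_of_mem_succs_of_eq {y : Placement n} (hy : y ∈ A.succs x) {i j : Fin n}
    (hij : y i = y j) : x i = x j := by
  by_contra hne
  exact disjoint_left.1 (h.disjoint _ _ (x.mem_config i) _ (x.mem_config j) hne)
    (mem_succs.1 hy i) (hij ▸ mem_succs.1 hy j)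

theorem expect_mult_le (i : Fin n) :
    𝔼 y ∈ A.succs x, (y.mult i : ℝ) ≤ 1 + (x.mult i - 1) / A.numDest x.config (x i) := by
  have expect_ite_le (j : Fin n) : 𝔼 y ∈ A.succs x, (if y j = y i then (1 : ℝ) else 0) ≤
      if j = i then 1 else if x j = x i then (A.numDest x.config (x i) : ℝ)⁻¹ else 0 := by
    split_ifs with hji hx
    · simp [hji, expect_const (A.succs_nonempty x)]
    · rw [← hx]
      exact expect_piFinset_ite_apply_eq_le _ hji
    · exact (expect_eq_zero fun y hy => if_neg fun hy' => hx (h.eq_of_mem_succs_of_eq x hy hy')).le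
  calc 𝔼 y ∈ A.succs x, (y.mult i : ℝ)
      = ∑ j, 𝔼 y ∈ A.succs x, (if y j = y i then (1 : ℝ) else 0) := by
        rw [← expect_sum_comm]
        exact expect_congr rfl fun y _ => y.cast_mult i
    _ ≤ ∑ j, if j = i then 1 else if x j = x i then (A.numDest x.config (x i) : ℝ)⁻¹ else 0 :=
        sum_le_sum fun j _ => expect_ite_le j
    _ = 1 + (x.mult i - 1) / A.numDest x.config (x i) := by
        rw [x.cast_mult i]
        exact sum_ite_eq_ite_apply_eq x i _

variable {L : ℝ}

theorem expect_potential_mult_le (hL : 0 ≤ L) (i : Fin n) :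
    𝔼 y ∈ A.succs x, potential L (y.mult i) ≤
      potential L (1 + (x.mult i - 1) / A.numDest x.config (x i)) := by
  have one_le_mult (y : Placement n) : (1 : ℝ) ≤ y.mult i := by exact_mod_cast y.one_le_mult i
  have one_le_expect : (1 : ℝ) ≤ 𝔼 y ∈ A.succs x, (y.mult i : ℝ) :=
    le_expect (A.succs_nonempty x) fun y _ => one_le_mult y
  have expect_le := h.expect_mult_le x i
  calc 𝔼 y ∈ A.succs x, potential L (y.mult i)
      ≤ potential L (𝔼 y ∈ A.succs x, (y.mult i : ℝ)) :=
        expect_comp_le_of_concaveOn (A.succs_nonempty x) (concaveOn_potential hL) fun y _ =>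
          one_pos.trans_le (one_le_mult y)
    _ ≤ potential L (1 + (x.mult i - 1) / A.numDest x.config (x i)) :=
        monotoneOn_potential hL (one_pos.trans_le one_le_expect)
          (one_pos.trans_le (one_le_expect.trans expect_le)) expect_le

open Classical in
theorem expect_potential_mult_add_logb_le (hL : 0 ≤ L) {i : Fin n}
    (hi : x.AtMultiplicity i → Real.logb 2 (A.numDest x.config (x i)) ≤ L) :
    𝔼 y ∈ A.succs x, potential L (y.mult i) +
        (if x.AtMultiplicity i then Real.logb 2 (A.numDest x.config (x i)) else 0) ≤
      potential L (x.mult i) := by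
  refine (add_le_add_left (h.expect_potential_mult_le x hL i) _).trans ?_
  split_ifs with hmult
  · exact potential_one_add_sub_one_div_add_logb_le ((x.atMultiplicity_iff_one_lt_mult i).1 hmult)
      (A.numDest_pos _ _) (hi hmult)
  · simp [Placement.mult_eq_one hmult]

theorem lintegral_sum_potential_add_roundBits_le (hL : 0 ≤ L)
    (hx : ∀ i, x.AtMultiplicity i → Real.logb 2 (A.numDest x.config (x i)) ≤ L) :
    ∫⁻ y, ENNReal.ofReal (∑ i, potential L (y.mult i)) ∂(A.stepKernel n x) + A.roundBits x ≤
      ENNReal.ofReal (∑ i, potential L (x.mult i)) := by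
  classical
  have potential_mult_nonneg (y : Placement n) : 0 ≤ ∑ i, potential L (y.mult i) :=
    sum_nonneg fun i _ => potential_nonneg hL (by exact_mod_cast y.one_le_mult i)
  rw [h.lintegral_stepKernel_ofReal x potential_mult_nonneg, roundBits_eq_ofReal_sum]
  refine (ENNReal.ofReal_add (expect_nonneg fun y _ => potential_mult_nonneg y)
    (sum_nonneg fun i _ => A.logb_numDest_nonneg _ _)).symm.trans_le (ENNReal.ofReal_le_ofReal ?_)
  calc 𝔼 y ∈ A.succs x, ∑ i, potential L (y.mult i) +
        ∑ i with x.AtMultiplicity i, Real.logb 2 (A.numDest x.config (x i))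
      = ∑ i, (𝔼 y ∈ A.succs x, potential L (y.mult i) +
          if x.AtMultiplicity i then Real.logb 2 (A.numDest x.config (x i)) else 0) :=
        (congr_arg₂ _ (expect_sum_comm _ _ _) (sum_filter _ _)).trans sum_add_distrib.symm
    _ ≤ ∑ i, potential L (x.mult i) :=
        sum_le_sum fun i _ => h.expect_potential_mult_add_logb_le x hL (hx i)

theorem bitComplexity_le (hL : 0 ≤ L)
    (hk : ∀ (x : Placement n) i, x.AtMultiplicity i →
      Real.logb 2 (A.numDest x.config (x i)) ≤ L) :
    A.bitComplexity n ≤ ENNReal.ofReal (n * potential L n) := by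
  refine iSup_le fun x₀ => ?_
  simp_rw [bitsToScatter_eq_costBefore, execution_eq_markovChain]
  calc ∫⁻ ω, costBefore {x | x.Scattered} A.roundBits ω ∂(markovChain (A.stepKernel n) (.dirac x₀))
      ≤ ∫⁻ x, ENNReal.ofReal (∑ i, potential L (x.mult i)) ∂(.dirac x₀) :=
        lintegral_costBefore_le _ .of_discrete .of_discrete .of_discrete fun x _ =>
          h.lintegral_sum_potential_add_roundBits_le x hL (hk x)
    _ = ENNReal.ofReal (∑ i, potential L (x₀.mult i)) := lintegral_dirac _ _
    _ ≤ ENNReal.ofReal (∑ _i : Fin n, potential L n) := by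
        refine ENNReal.ofReal_le_ofReal (sum_le_sum fun i _ => ?_)
        have one_le : (1 : ℝ) ≤ x₀.mult i := by exact_mod_cast x₀.one_le_mult i
        have le_card : (x₀.mult i : ℝ) ≤ n := by exact_mod_cast x₀.mult_le i
        exact monotoneOn_potential hL (one_pos.trans_le one_le)
          (one_pos.trans_le (one_le.trans le_card)) le_card
    _ = ENNReal.ofReal (n * potential L n) := by simp

theorem bitComplexity_le_mul_logb {K : ℕ} {c : ℝ}
    (hk : ∀ (x : Placement n) i, x.AtMultiplicity i →
      (A.numDest x.config (x i) : ℝ) ≤ c * (n : ℝ) ^ K) :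
    A.bitComplexity n ≤ ENNReal.ofReal
      ((3 + 4 * (Real.logb 2 (max c 1) + K)) * (n * Real.logb 2 n)) := by
  rcases n.eq_zero_or_pos with rfl | hn
  · simpa using h.bitComplexity_le (n := 0) le_rfl fun _ i => i.elim0
  have hn' : (1 : ℝ) ≤ n := by exact_mod_cast hn
  have logb_c_nonneg : 0 ≤ Real.logb 2 (max c 1) :=
    Real.logb_nonneg one_lt_two (le_max_right c 1)
  have logb_n_nonneg : 0 ≤ Real.logb 2 n := Real.logb_nonneg one_lt_two hn'
  have logb_numDest_le (x : Placement n) (i : Fin n) (hi : x.AtMultiplicity i) :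
      Real.logb 2 (A.numDest x.config (x i)) ≤ Real.logb 2 (max c 1) + K * Real.logb 2 n := by
    have numDest_pos : (0 : ℝ) < A.numDest x.config (x i) := by exact_mod_cast A.numDest_pos _ _
    rw [← Real.logb_pow, ← Real.logb_mul (by positivity) (by positivity)]
    exact Real.logb_le_logb_of_le one_lt_two numDest_pos
      ((hk x i hi).trans (by gcongr; exact le_max_left c 1))
  calc A.bitComplexity n
      ≤ ENNReal.ofReal (n * potential (Real.logb 2 (max c 1) + K * Real.logb 2 n) n) :=
        h.bitComplexity_le (by positivity) logb_numDest_le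
    _ ≤ ENNReal.ofReal (n * ((3 + 4 * (Real.logb 2 (max c 1) + K)) * Real.logb 2 n)) := by
        gcongr
        exact potential_add_mul_logb_le logb_c_nonneg K.cast_nonneg hn'
    _ = ENNReal.ofReal ((3 + 4 * (Real.logb 2 (max c 1) + K)) * (n * Real.logb 2 n)) := by
        rw [mul_left_comm]

end Algorithm.IsCanonical

namespace Algorithm.IsScattering

variable {B : Algorithm} (h : B.IsScattering) {n : ℕ}
include h

theorem symmetryBits_le_lintegral_bitsToScatter (x₀ : Placement n) :
    ENNReal.ofReal x₀.symmetryBits ≤ ∫⁻ ω, B.bitsToScatter ω ∂(B.execution x₀) := by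
  simp_rw [bitsToScatter_eq_costBefore, execution_eq_markovChain]
  have hit : ∀ᵐ ω ∂(markovChain (B.stepKernel n) (.dirac x₀)), ∃ t, ω t ∈ {x | x.Scattered} := by
    rw [← execution_eq_markovChain]
    exact h n x₀
  calc ENNReal.ofReal x₀.symmetryBits
      = ∫⁻ x, ENNReal.ofReal (Placement.symmetryBits x) ∂(.dirac x₀) :=
        (lintegral_dirac x₀ fun x => ENNReal.ofReal (Placement.symmetryBits x)).symm
    _ ≤ _ := lintegral_le_lintegral_costBefore _ .of_discrete .of_discrete .of_discrete
        (fun x hx => by rw [Placement.symmetryBits_eq_zero hx, ENNReal.ofReal_zero])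
        (fun x _ => B.symmetryBits_le_lintegral_add_roundBits x) ENNReal.ofReal_ne_top
        (fun x => ENNReal.ofReal_le_ofReal x.symmetryBits_le) hit

theorem ofReal_logb_factorial_le_bitComplexity (n : ℕ) :
    ENNReal.ofReal (Real.logb 2 n.factorial) ≤ B.bitComplexity n := by
  let gathered : Placement n := fun _ => 0
  have symmetryBits_gathered : gathered.symmetryBits = Real.logb 2 n.factorial :=
    Placement.symmetryBits_eq_of_forall_eq fun _ => rfl
  rw [← symmetryBits_gathered]
  exact le_iSup_of_le gathered (h.symmetryBits_le_lintegral_bitsToScatter gathered)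

theorem ofReal_mul_logb_le_two_mul_bitComplexity (n : ℕ) :
    ENNReal.ofReal (n * Real.logb 2 n) ≤ 2 * B.bitComplexity n := by
  calc ENNReal.ofReal (n * Real.logb 2 n) ≤ ENNReal.ofReal (2 * Real.logb 2 n.factorial) :=
        ENNReal.ofReal_le_ofReal (mul_logb_le_two_mul_logb_factorial one_lt_two n)
    _ = 2 * ENNReal.ofReal (Real.logb 2 n.factorial) := by
        rw [ENNReal.ofReal_mul zero_le_two, ENNReal.ofReal_ofNat]
    _ ≤ 2 * B.bitComplexity n := by
        gcongr
        exact h.ofReal_logb_factorial_le_bitComplexity n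

end Algorithm.IsScattering

end Robots

theorem mainTheorem2_general (A : Robots.Algorithm) (hcan : A.IsCanonical) {K n₀ : ℕ} {c : ℝ}
    (hk : ∀ n, n₀ ≤ n → ∀ (x : Robots.Placement n) i, x.AtMultiplicity i →
      (A.numDest x.config (x i) : ℝ) ≤ c * (n : ℝ) ^ K) :
    (∃ c' : ℝ, ∀ n : ℕ, n₀ ≤ n →
      A.bitComplexity n ≤ ENNReal.ofReal (c' * ((n : ℝ) * Real.logb 2 n))) ∧
    A.RandomBitOptimal := by
  set c' : ℝ := 3 + 4 * (Real.logb 2 (max c 1) + K)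
  have upper (n : ℕ) (hn : n₀ ≤ n) :
      A.bitComplexity n ≤ ENNReal.ofReal (c' * (n * Real.logb 2 n)) :=
    hcan.bitComplexity_le_mul_logb (hk n hn)
  have c'_nonneg : 0 ≤ c' := by
    have := Real.logb_nonneg one_lt_two (le_max_right c 1)
    positivity
  refine ⟨⟨c', upper⟩, fun B hB => ⟨c'.toNNReal * 2, n₀, fun n hn => ?_⟩⟩
  calc A.bitComplexity n ≤ ENNReal.ofReal (c' * (n * Real.logb 2 n)) := upper n hn
    _ = ENNReal.ofReal c' * ENNReal.ofReal (n * Real.logb 2 n) := ENNReal.ofReal_mul c'_nonneg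
    _ ≤ ENNReal.ofReal c' * (2 * B.bitComplexity n) := by
        gcongr
        exact hB.ofReal_mul_logb_le_two_mul_bitComplexity n
    _ = ↑(c'.toNNReal * 2) * B.bitComplexity n := by
        rw [ENNReal.coe_mul, ENNReal.coe_ofNat, mul_assoc, ENNReal.ofReal]

theorem mainTheorem2 (A : Robots.Algorithm) (hcan : A.IsCanonical) (hscat : A.IsScattering)
    (K n₀ : ℕ) (c : ℝ)
    (hk : ∀ (C : Multiset Robots.Plane) (P : Robots.Plane), n₀ ≤ C.card → P ∈ C →
      (A.numDest C P : ℝ) ≤ c * (C.card : ℝ) ^ K) :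
    (∃ c' : ℝ, ∀ n : ℕ, n₀ ≤ n →
      A.bitComplexity n ≤ ENNReal.ofReal (c' * ((n : ℝ) * Real.logb 2 n))) ∧
    A.RandomBitOptimal :=
  mainTheorem2_general A hcan fun n hn x i _ => by
    simpa using hk x.config (x i) (by simpa using hn) (x.mem_config i)
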